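/- Let $S$ be a finite set of points in the plane in convex position (no point of $S$ lies in the convex hull of the other points). An \emph{edge-labeled plane tree} on $S$ is a straight-line spanning tree with vertex set $S$ whose edges meet pairwise only in common endpoints, together with a bijection from its edges to $\{1,\dots,|S|-1\}$. Let $\mathcal{L}(S)$ be the set of these trees. Let $T_1,T_2\in\mathcal{L}(S)$ have edge sets $E_1,E_2$. A pair $(e_1,e_2)\in (E_1\setminus E_2)\times(E_2\setminus E_1)$ is called a \emph{slide pair} if $e_1=pq$ and $e_2=pr$ for some $p,q,r\in S$ with $qr\in E_1\cap E_2$, both $E_1\cup\{e_2\}$ and $\{e_1\}\cup E_2$ are noncrossing, and no edge of $E_1\cup E_2$ meets the interior of the triangle $pqr$. An \emph{edge slide} transforms $T_1$ into $T_2$ if $E_1\setminus E_2=\{e_1\}$ and $E_2\setminus E_1=\{e_2\}$ for a slide pair $(e_1,e_2)$, the label of $e_2$ in $T_2$ is the label of $e_1$ in $T_1$, and every edge of $E_1\cap E_2$ has the same label in both trees. A \emph{simultaneous edge slide} transforms $T_1$ into $T_2$ if there is a bijection $\pi:E_1\setminus E_2\to E_2\setminus E_1$ such that for every $e\in E_1\setminus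 E_2$ the pair $(e,\pi(e))$ is a slide pair and the label of $\pi(e)$ in $T_2$ is the label of $e$ in $T_1$, and every edge of $E_1\cap E_2$ has the same label in both trees. \textbf{Theorem.} There is an absolute constant $c>0$ such that the following holds. Let $S$ be a set of $n\ge 3$ points in the plane in convex position, and let $T\in\mathcal{L}(S)$. Then there exists $T'\in\mathcal{L}(S)$ such that every sequence of edge slides that transforms $T$ into $T'$ consists of at least $c\,n\log n$ edge slides, and every sequence of simultaneous edge slides that transforms $T$ into $T'$ consists of at least $c\log n$ simultaneous edge slides. -/

import Mathlib

/-- The Euclidean plane. -/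
abbrev Plane : Type := EuclideanSpace ℝ (Fin 2)

/-- A finite planar point set is in convex position if no point of it lies in the convex hull of
the others. -/
def InConvexPosition (S : Finset Plane) : Prop :=
  ConvexIndependent ℝ (fun x : S => (x : Plane))

/-- The straight-line segment drawn for an edge, i.e. for an unordered pair of points of `S`. -/
def edgeSegment {S : Finset Plane} (e : Sym2 S) : Set Plane :=
  convexHull ℝ ((fun x : S => (x : Plane)) '' {x : S | x ∈ e})

/-- The closed triangle spanned by three points of `S`. -/
def closedTriangle {S : Finset Plane} (p q r : S) : Set Plane :=
  convexHull ℝ {(p : Plane), (q : Plane), (r : Plane)}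

/-- A set of edges on `S` is noncrossing if any two distinct edges meet, as segments, in common
endpoints only. -/
def Noncrossing {S : Finset Plane} (E : Set (Sym2 S)) : Prop :=
  ∀ e ∈ E, ∀ f ∈ E, e ≠ f → ∀ x ∈ edgeSegment e ∩ edgeSegment f,
    ∃ v : S, (v : Plane) = x ∧ v ∈ e ∧ v ∈ f

/-- An edge-labeled noncrossing straight-line spanning tree on `S`: a tree with vertex set `S`
whose segments are noncrossing, with a bijection from its edges onto `|S| - 1` labels. -/
structure LabeledPlaneTree (S : Finset Plane) where
  graph : SimpleGraph S
  isTree : graph.IsTree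
  noncrossing : Noncrossing graph.edgeSet
  label : graph.edgeSet ≃ Fin (S.card - 1)

/-- The geometric conditions of an edge slide on the pair (old edge `e₁`, new edge `e₂`) when the
edge set `E₁` is replaced by `E₂`: the edges are `e₁ = pq` and `e₂ = pr` with a common endpoint
`p`, each is compatible (noncrossing) with the other tree, no edge of either tree meets the
interior of the triangle `pqr`, and `qr` is an edge of both trees. -/
def SlideCondition {S : Finset Plane} (E₁ E₂ : Set (Sym2 S)) (e₁ e₂ : Sym2 S) : Prop :=
  ∃ p q r : S, e₁ = s(p, q) ∧ e₂ = s(p, r) ∧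
    Noncrossing (E₁ ∪ {e₂}) ∧ Noncrossing ({e₁} ∪ E₂) ∧
    (∀ e ∈ E₁ ∪ E₂, Disjoint (edgeSegment e) (interior (closedTriangle p q r))) ∧
    s(q, r) ∈ E₁ ∩ E₂

/-- Edges common to both trees carry the same label in both. -/
def KeepsLabels {S : Finset Plane} (T₁ T₂ : LabeledPlaneTree S) : Prop :=
  ∀ (e : Sym2 S) (h₁ : e ∈ T₁.graph.edgeSet) (h₂ : e ∈ T₂.graph.edgeSet),
    T₁.label ⟨e, h₁⟩ = T₂.label ⟨e, h₂⟩

/-- An edge slide between edge-labeled trees: exactly one edge `e₁` is replaced by one edge `e₂`,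
the geometric conditions hold, `e₂` receives the label of `e₁`, all other labels stay. -/
def EdgeSlide {S : Finset Plane} (T₁ T₂ : LabeledPlaneTree S) : Prop :=
  ∃ (e₁ e₂ : Sym2 S) (h₁ : e₁ ∈ T₁.graph.edgeSet) (h₂ : e₂ ∈ T₂.graph.edgeSet),
    T₁.graph.edgeSet \ T₂.graph.edgeSet = {e₁} ∧
    T₂.graph.edgeSet \ T₁.graph.edgeSet = {e₂} ∧
    SlideCondition T₁.graph.edgeSet T₂.graph.edgeSet e₁ e₂ ∧
    T₂.label ⟨e₂, h₂⟩ = T₁.label ⟨e₁, h₁⟩ ∧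
    KeepsLabels T₁ T₂

/-- A simultaneous edge slide between edge-labeled trees: there is a bijection from the old edges
to the new edges such that every corresponding pair satisfies the geometric conditions of an edge
slide and every new edge receives the label of its old edge; common edges keep their labels. -/
def SimultaneousEdgeSlide {S : Finset Plane} (T₁ T₂ : LabeledPlaneTree S) : Prop :=
  ∃ π : ↥(T₁.graph.edgeSet \ T₂.graph.edgeSet) ≃ ↥(T₂.graph.edgeSet \ T₁.graph.edgeSet),
    (∀ e : ↥(T₁.graph.edgeSet \ T₂.graph.edgeSet),
      SlideCondition T₁.graph.edgeSet T₂.graph.edgeSet (e : Sym2 S) (π e : Sym2 S) ∧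
      T₂.label ⟨(π e : Sym2 S), (π e).2.1⟩ = T₁.label ⟨(e : Sym2 S), e.2.1⟩) ∧
    KeepsLabels T₁ T₂

/-- `b` is obtained from `a` by a sequence of exactly `m` operations. -/
def TransformsIn {α : Type*} (op : α → α → Prop) (m : ℕ) (a b : α) : Prop :=
  ∃ t : ℕ → α, t 0 = a ∧ t m = b ∧ ∀ i < m, op (t i) (t (i + 1))

/-! The proof is a count over the $(n-1)!$ relabelings of $T$, which are pairwise distinct trees. If
every relabeling were close to $T$, there would be too few short sequences of slides to reach them
all.

Counting sequences slide by slide gives about $n$ choices per slide and only a linear bound. The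
gain comes from locality. The agents are the labels, and a slide of $pq$ to $pr$ along $qr$ involves
just two of them: the sliding edge and its base $qr$. Each sees one of 8 events: its role, which of
its ends is used, and the side of the turn. Given the present tree, one such event determines the
whole slide, since noncrossing leaves at most one candidate on each side
(`Move.Enabled.eq_of_event`). Slides with no label in common commute, because two triangles with
exactly one crossing pair of sides must share another side (`nonCross_of_triangles`).

The final tree is therefore determined by the local histories of the labels
(`IsLocal.eq_of_history_eq`), as for traces of partially commuting words. After $M$ slides the
histories have total length at most $2M$; written with $n-1$ separators they give at most
$10^{n-1+2M}$ outcomes. A simultaneous slide is determined by one of 5 instructions per label (stay,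
or an end and a side), so $M$ of them give at most $5^{(n-1)M}$ outcomes. Compared with $(n-1)!$,
this yields the bounds $n\log n$ and $\log n$, and one relabeling is far from $T$ in both senses. -/

namespace EdgeSlideBound

/-! ### Local histories and the counting of outcomes -/

section Asynchronous

variable {O A I Γ : Type*}

/-- `Run R w x y`: performing the operations of the word `w` one after the other leads from `x`
to `y`. -/
inductive Run (R : O → A → A → Prop) : List O → A → A → Prop
  | nil (x : A) : Run R [] x x
  | cons {o : O} {w : List O} {x y z : A} : R o x y → Run R w y z → Run R (o :: w) x z

/-- Two operations are independent if no agent takes part in both. -/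
def Independent (ev : O → I → Option Γ) (o o' : O) : Prop :=
  ∀ k, ev o k = none ∨ ev o' k = none

/-- A system of operations in which every agent `k` experiences the operation `o` as the local
event `ev o k` (if it takes part), operations without common agents commute, and an enabled
operation is determined by the local event of any one of its agents. -/
structure IsLocal (R : O → A → A → Prop) (ev : O → I → Option Γ) : Prop where
  det : ∀ {o x y z}, R o x y → R o x z → y = z
  active : ∀ o, ∃ k γ, ev o k = some γ
  unique : ∀ {o o' x y z k γ}, R o x y → R o' x z → ev o k = some γ → ev o' k = some γ → o = o'
  swap : ∀ {o o' x y z}, Independent ev o o' → R o x y → R o' y z → ∃ y', R o' x y' ∧ R o y' z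
  persist : ∀ {o o' x y z}, Independent ev o o' → R o x y → R o' x z → ∃ u, R o z u

/-- The sequence of local events that agent `k` experiences along a word of operations. -/
def history (ev : O → I → Option Γ) (w : List O) (k : I) : List Γ :=
  w.filterMap fun o => ev o k

theorem history_cons_some {ev : O → I → Option Γ} {o : O} {k : I} {γ : Γ} (w : List O)
    (h : ev o k = some γ) : history ev (o :: w) k = γ :: history ev w k := by
  simp [history, h]

theorem history_cons_none {ev : O → I → Option Γ} {o : O} {k : I} (w : List O)
    (h : ev o k = none) : history ev (o :: w) k = history ev w k := by
  simp [history, h]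

variable {R : O → A → A → Prop} {ev : O → I → Option Γ}

/-- An enabled operation whose events come first in the histories of its agents can be moved to
the front. -/
theorem IsLocal.extract (hR : IsLocal R ev) {o : O} {w : List O} {x y z : A} (hw : Run R w x z)
    (ho : R o x y) (hh : ∀ k γ, ev o k = some γ → ∃ l, history ev w k = γ :: l) :
    ∃ w', Run R w' y z ∧ ∀ k, history ev w k = history ev (o :: w') k := by
  induction hw generalizing y with
  | nil x =>
    obtain ⟨k, γ, hk⟩ := hR.active o
    obtain ⟨l, hl⟩ := hh k γ hk
    simp [history] at hl
  | @cons o' w x x' z hs hw ih =>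
    -- If `o` and `o'` share no agent, `o` stays enabled after `o'`; it is extracted from the tail
    -- and then exchanged with `o'`.
    by_cases hind : Independent ev o o'
    · obtain ⟨y', hy'⟩ := hR.persist hind ho hs
      obtain ⟨w', hw', hh'⟩ := ih hy' fun k γ hk => by
        obtain ⟨l, hl⟩ := hh k γ hk
        have hn : ev o' k = none := (hind k).resolve_left (by simp [hk])
        exact ⟨l, by rw [← hl, history_cons_none _ hn]⟩
      obtain ⟨u, hu, hu'⟩ := hR.swap (fun k => (hind k).symm) hs hy'
      obtain rfl := hR.det ho hu
      refine ⟨o' :: w', .cons hu' hw', fun k => ?_⟩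
      have hk := hh' k
      rcases hind k with h | h
      · rw [history_cons_none _ h] at hk ⊢
        cases h' : ev o' k with
        | none => rw [history_cons_none _ h', history_cons_none _ h', hk]
        | some γ => rw [history_cons_some _ h', history_cons_some _ h', hk]
      · rw [history_cons_none _ h, hk]
        cases h' : ev o k with
        | none => rw [history_cons_none _ h', history_cons_none _ h', history_cons_none _ h]
        | some γ => rw [history_cons_some _ h', history_cons_some _ h', history_cons_none _ h]
    -- A common agent has the event of `o` next in its history, and the event of `o'` as well, so by
    -- `unique` the two operations coincide.
    · simp only [Independent, not_forall, not_or, ← ne_eq, Option.ne_none_iff_exists'] at hind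
      obtain ⟨k, ⟨γ, hγ⟩, γ', hγ'⟩ := hind
      obtain ⟨l, hl⟩ := hh k γ hγ
      rw [history_cons_some _ hγ'] at hl
      obtain rfl : γ' = γ := (List.cons.inj hl).1
      obtain rfl := hR.unique ho hs hγ hγ'
      obtain rfl := hR.det ho hs
      exact ⟨w, hw, fun _ => rfl⟩

/-- The outcome of a run depends only on the local histories. -/
theorem IsLocal.eq_of_history_eq (hR : IsLocal R ev) {w w' : List O} {x y y' : A}
    (hw : Run R w x y) (hw' : Run R w' x y') (h : ∀ k, history ev w k = history ev w' k) :
    y = y' := by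
  induction hw generalizing w' with
  | nil x =>
    cases hw' with
    | nil => rfl
    | @cons o w' _ _ _ hs hw' =>
      obtain ⟨k, γ, hk⟩ := hR.active o
      have := h k
      rw [history_cons_some _ hk] at this
      simp [history] at this
  | @cons o w x x' y hs hw ih =>
    obtain ⟨w'', hw'', hh⟩ := hR.extract hw' hs fun k γ hk =>
      ⟨history ev w k, by rw [← h k, history_cons_some _ hk]⟩
    refine ih hw'' fun k => ?_
    have hk := (h k).trans (hh k)
    cases h' : ev o k with
    | none => rwa [history_cons_none _ h', history_cons_none _ h'] at hk
    | some γ =>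
      rw [history_cons_some _ h', history_cons_some _ h'] at hk
      exact (List.cons.inj hk).2

/-- A list of lists, written as one list with separators. -/
def joinWithSeparators (L : List (List Γ)) : List (Option Γ) :=
  L.flatMap fun l => l.map some ++ [none]

theorem map_some_append_none_inj {l l' : List Γ} {r r' : List (Option Γ)}
    (h : l.map some ++ none :: r = l'.map some ++ none :: r') : l = l' ∧ r = r' := by
  induction l generalizing l' with
  | nil => cases l' <;> simp_all
  | cons a l ih =>
    cases l' with
    | nil => simp at h
    | cons b l' =>
      simp only [List.map_cons, List.cons_append, List.cons.injEq, Option.some.injEq] at h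
      obtain ⟨h1, h2⟩ := ih h.2
      exact ⟨by rw [h.1, h1], h2⟩

theorem joinWithSeparators_injective :
    Function.Injective (joinWithSeparators : List (List Γ) → List (Option Γ)) := by
  intro L L' h
  induction L generalizing L' with
  | nil => cases L' <;> simp_all [joinWithSeparators]
  | cons l L ih =>
    cases L' with
    | nil => simp [joinWithSeparators] at h
    | cons l' L' =>
      simp only [joinWithSeparators, List.flatMap_cons, List.append_assoc,
        List.singleton_append] at h
      obtain ⟨h1, h2⟩ := map_some_append_none_inj h
      rw [h1, ih h2]

theorem length_joinWithSeparators (L : List (List Γ)) :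
    (joinWithSeparators L).length = (L.map List.length).sum + L.length := by
  induction L with
  | nil => simp [joinWithSeparators]
  | cons l L ih =>
    simp only [joinWithSeparators, List.flatMap_cons, List.length_append] at ih ⊢
    simp [ih]
    omega

theorem sum_length_history_le [Fintype I] {d : ℕ}
    (hd : ∀ o, ∑ k, (ev o k).toList.length ≤ d) (w : List O) :
    ∑ k, (history ev w k).length ≤ d * w.length := by
  induction w with
  | nil => simp [history]
  | cons o w ih =>
    have : ∀ k, (history ev (o :: w) k).length =
        (ev o k).toList.length + (history ev w k).length := by
      intro k
      cases h : ev o k with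
      | none => simp [history_cons_none _ h]
      | some γ => simp [history_cons_some _ h, add_comm]
    simp only [this, Finset.sum_add_distrib, List.length_cons, mul_add, mul_one]
    have := hd o
    omega

/-- Only exponentially many outcomes are reachable by short runs of a local system. -/
theorem IsLocal.card_le [Fintype Γ] {N d M : ℕ} {ev : O → Fin N → Option Γ} (hR : IsLocal R ev)
    (hd : ∀ o, ∑ k, (ev o k).toList.length ≤ d) {ι : Type*} (B : Finset ι) (x : A)
    (P : ι → A → Prop) (hP : ∀ i j y, P i y → P j y → i = j)
    (hB : ∀ i ∈ B, ∃ w y, w.length ≤ M ∧ Run R w x y ∧ P i y) :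
    B.card ≤ (Fintype.card Γ + 2) ^ (N + d * M) := by
  choose! w y hw hrun hPy using hB
  let word (i : ι) : List (Option Γ) := joinWithSeparators (List.ofFn (history ev (w i)))
  -- The outer `none` pads the word to fixed length and the inner one is the separator, hence the
  -- alphabet size `card Γ + 2`.
  let code (i : ι) (t : Fin (N + d * M)) : Option (Option Γ) := (word i)[(t : ℕ)]?
  have hlen : ∀ i ∈ B, (word i).length ≤ N + d * M := by
    intro i hi
    have h1 := sum_length_history_le hd (w i)
    have h2 := Nat.mul_le_mul_left d (hw i hi)
    simp only [word, length_joinWithSeparators, List.map_ofFn, List.length_ofFn, List.sum_ofFn,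
      Function.comp_def]
    omega
  have hinj : Set.InjOn code B := by
    intro i hi j hj h
    have hword : word i = word j := by
      apply List.ext_getElem?
      intro t
      by_cases ht : t < N + d * M
      · exact congrFun h ⟨t, ht⟩
      · rw [List.getElem?_eq_none (by have := hlen i hi; omega),
          List.getElem?_eq_none (by have := hlen j hj; omega)]
    have hh := List.ofFn_injective (joinWithSeparators_injective hword)
    have hy := hR.eq_of_history_eq (hrun i hi) (hrun j hj) (congrFun hh)
    exact hP i j _ (hPy i hi) (hy ▸ hPy j hj)
  have := Finset.card_le_card_of_injOn (t := Finset.univ) code (fun _ _ => Finset.mem_univ _) hinj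
  simpa [Fintype.card_option] using this

/-- If every step of `R` is determined by a code from `K`, few outcomes are reachable. -/
theorem card_le_of_step_code {K : Type*} [Fintype K] {R : A → A → Prop} (hrefl : ∀ x, R x x)
    (C : A → A → K → Prop) (hC : ∀ x y, R x y → ∃ κ, C x y κ)
    (huniq : ∀ x y z κ, C x y κ → C x z κ → y = z)
    {M : ℕ} {x : A} {ι : Type*} (B : Finset ι) (f : ι → A) (hf : Function.Injective f)
    (hB : ∀ i ∈ B, ∃ m ≤ M, TransformsIn R m x (f i)) :
    B.card ≤ Fintype.card K ^ M := by
  have hB' : ∀ i ∈ B, ∃ (t : ℕ → A) (κ : Fin M → K), t 0 = x ∧ t M = f i ∧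
      ∀ s : Fin M, C (t s) (t (s + 1)) (κ s) := by
    intro i hi
    obtain ⟨m, hm, t, h0, h1, h2⟩ := hB i hi
    -- A shorter sequence is prolonged to exactly `M` steps by standing still, which `hrefl`
    -- permits.
    have hstep : ∀ s : Fin M, R (t (min s m)) (t (min (s + 1) m)) := by
      intro s
      rcases lt_or_ge (s : ℕ) m with h | h
      · simpa [min_eq_left h.le, min_eq_left (Nat.succ_le_of_lt h)] using h2 s h
      · simpa [min_eq_right h, min_eq_right (h.trans (Nat.le_succ _))] using hrefl _
    choose κ hκ using fun s => hC _ _ (hstep s)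
    exact ⟨fun s => t (min s m), κ, by simpa using h0, by simpa [hm] using h1, hκ⟩
  rcases B.eq_empty_or_nonempty with rfl | ⟨i₀, hi₀⟩
  · simp
  have : Nonempty A := ⟨x⟩
  have : Nonempty (Fin M → K) := let ⟨_, κ, _⟩ := hB' i₀ hi₀; ⟨κ⟩
  choose! t κ h0 h1 h2 using hB'
  have hinj : Set.InjOn κ B := by
    intro i hi j hj h
    have heq : ∀ s ≤ M, t i s = t j s := by
      intro s
      induction s with
      | zero => intro _; rw [h0 i hi, h0 j hj]
      | succ s ih =>
        intro hs
        have hi' := h2 i hi ⟨s, hs⟩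
        have hj' := h2 j hj ⟨s, hs⟩
        dsimp only at hi' hj'
        rw [ih (by omega), h] at hi'
        exact huniq _ _ _ _ hi' hj'
    exact hf (by rw [← h1 i hi, ← h1 j hj, heq M le_rfl])
  have := Finset.card_le_card_of_injOn (t := Finset.univ) κ (fun _ _ => Finset.mem_univ _) hinj
  simpa using this

end Asynchronous

end EdgeSlideBound

namespace EdgeSlideBound

/-! ### Orientations and noncrossing chords -/

section Chirotope

/-- The orientations of the triples of a planar point set in convex position. -/
structure Chirotope (V : Type*) where
  χ : V → V → V → ℝ
  cyc : ∀ a b c, χ a b c = χ b c a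
  swap : ∀ a b c, χ a b c = -χ b a c
  ne_zero : ∀ {a b c}, a ≠ b → b ≠ c → a ≠ c → χ a b c ≠ 0
  cross_symm : ∀ {a b c d}, χ a b c * χ a b d < 0 → χ c d a * χ c d b < 0

variable {V I : Type*} (X : Chirotope V)

namespace Chirotope

theorem self_left (a b : V) : X.χ a a b = 0 := by
  have := X.swap a a b
  linarith

theorem self_right (a b : V) : X.χ a b b = 0 := by
  rw [X.cyc, X.cyc, X.cyc, X.cyc, X.self_left]

theorem self_outer (a b : V) : X.χ a b a = 0 := by
  rw [X.cyc, X.self_right]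

/-- Two chords do not cross properly. -/
def NonCross (e f : Sym2 V) : Prop :=
  ∀ a b c d, e = s(a, b) → f = s(c, d) → 0 ≤ X.χ a b c * X.χ a b d

variable {X}

theorem NonCross.symm {e f : Sym2 V} (h : X.NonCross e f) : X.NonCross f e := by
  intro a b c d he hf
  by_contra! hlt
  exact absurd (h c d a b hf he) (not_le.2 (X.cross_symm hlt))

theorem NonCross.le {a b c d : V} (h : X.NonCross s(a, b) s(c, d)) :
    0 ≤ X.χ a b c * X.χ a b d := h a b c d rfl rfl

theorem nonCross_of_le {a b c d : V} (h : 0 ≤ X.χ a b c * X.χ a b d) :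
    X.NonCross s(a, b) s(c, d) := by
  intro a' b' c' d' he hf
  rw [Sym2.eq_iff] at he hf
  rcases he with ⟨rfl, rfl⟩ | ⟨rfl, rfl⟩ <;> rcases hf with ⟨rfl, rfl⟩ | ⟨rfl, rfl⟩
  · exact h
  · rwa [mul_comm]
  · rwa [X.swap b a c, X.swap b a d, neg_mul_neg]
  · rwa [X.swap b a c, X.swap b a d, neg_mul_neg, mul_comm]

/-- Chords with a common endpoint do not cross. -/
theorem nonCross_of_common (a b c : V) : X.NonCross s(a, b) s(a, c) :=
  nonCross_of_le (by simp [X.self_outer])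

/-- The line `cd` separates `a` from `b`, so an apex `e` off the line would be separated from one of
them, and the segment joining these two would cross `cd`. -/
theorem apex_mem {a b c d e : V} (hcd : c ≠ d) (h : X.χ c d a * X.χ c d b < 0)
    (h1 : X.NonCross s(a, e) s(c, d)) (h2 : X.NonCross s(b, e) s(c, d)) : e = c ∨ e = d := by
  by_contra! he
  have hne := X.ne_zero hcd he.2.symm he.1.symm
  have h1 := h1.symm.le
  have h2 := h2.symm.le
  rcases lt_or_gt_of_ne hne with hn | hn <;> rcases mul_neg_iff.1 h with ⟨ha, hb⟩ | ⟨ha, hb⟩ <;>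
    nlinarith

/-- If two triangles have a single pair of crossing sides, they share another side. -/
theorem nonCross_of_triangles {a b c a' b' c' : V} (h1 : X.NonCross s(a, c) s(a', b'))
    (h2 : X.NonCross s(b, c) s(a', b')) (h3 : X.NonCross s(a, b) s(a', c'))
    (h4 : X.NonCross s(a, b) s(b', c')) (n1 : s(a, c) ≠ s(a', c')) (n2 : s(a, c) ≠ s(b', c'))
    (n3 : s(b, c) ≠ s(a', c')) (n4 : s(b, c) ≠ s(b', c')) : X.NonCross s(a, b) s(a', b') := by
  apply nonCross_of_le
  by_contra! hlt
  have hlt' := X.cross_symm hlt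
  have hab : a ≠ b := by rintro rfl; simp [X.self_left] at hlt
  have hab' : a' ≠ b' := by rintro rfl; simp [X.self_left] at hlt'
  rcases apex_mem hab' hlt' h1 h2 with rfl | rfl <;>
    rcases apex_mem hab hlt h3.symm h4.symm with rfl | rfl
  · exact n1 Sym2.eq_swap
  · exact n3 Sym2.eq_swap
  · exact n2 Sym2.eq_swap
  · exact n4 Sym2.eq_swap

/-- Among the triangles on one side of a chord `pq` whose sides do not cross each other, at most
one apex can be joined to `q`. -/
theorem eq_of_same_side {p q r r' : V} (h : 0 < X.χ p q r) (h' : 0 < X.χ p q r')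
    (h1 : X.NonCross s(q, r) s(p, r')) (h2 : X.NonCross s(q, r') s(p, r)) : r = r' := by
  by_contra hne
  have hq : ∀ {x}, 0 < X.χ p q x → q ≠ x := by rintro x hx rfl; simp [X.self_right] at hx
  have e1 := h1.le
  have e2 := h2.le
  have n := X.ne_zero (hq h) hne (hq h')
  rw [← X.cyc p q r] at e1
  rw [← X.cyc p q r'] at e2
  -- Each noncrossing condition asks that one of `r`, `r'` not precede the other in the angular
  -- order around `q`; the two orders are opposite, so both orientations vanish.
  have s1 : 0 ≤ X.χ q r r' := nonneg_of_mul_nonneg_right e1 h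
  have s2 : 0 ≤ X.χ q r' r := nonneg_of_mul_nonneg_right e2 h'
  have s3 : X.χ q r r' = - X.χ q r' r := by rw [X.cyc, X.swap r r' q, X.cyc, X.cyc]
  exact n (by linarith)

/-- The mirror image of a chirotope. -/
def mirror (X : Chirotope V) : Chirotope V where
  χ a b c := -X.χ a b c
  cyc a b c := by rw [X.cyc]
  swap a b c := by rw [X.swap]
  ne_zero h1 h2 h3 := neg_ne_zero.2 (X.ne_zero h1 h2 h3)
  cross_symm h := by
    rw [neg_mul_neg] at h ⊢
    exact X.cross_symm h

theorem NonCross.mirror {e f : Sym2 V} (h : X.NonCross e f) : X.mirror.NonCross e f := by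
  intro a b c d he hf
  simpa [Chirotope.mirror] using h a b c d he hf

theorem eq_of_same_sign {p q r r' : V} (h : X.χ p q r ≠ 0) (h' : X.χ p q r' ≠ 0)
    (hs : 0 < X.χ p q r ↔ 0 < X.χ p q r')
    (h1 : X.NonCross s(q, r) s(p, r')) (h2 : X.NonCross s(q, r') s(p, r)) : r = r' := by
  rcases lt_or_gt_of_ne h with hn | hp
  · have hn' : X.χ p q r' < 0 := lt_of_le_of_ne (not_lt.1 (mt hs.2 hn.not_gt)) h'
    exact eq_of_same_side (X := X.mirror) (neg_pos.2 hn) (neg_pos.2 hn') h1.mirror h2.mirror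
  · exact eq_of_same_side hp (hs.1 hp) h1 h2

end Chirotope

/-! ### Slides as moves of a local system -/

open Chirotope

/-- The segment with label `k` in a configuration given by the two ends of every label. -/
def edge (a : I → Bool → V) (k : I) : Sym2 V := s(a k false, a k true)

theorem edge_eq (a : I → Bool → V) (k : I) (b : Bool) : edge a k = s(a k (!b), a k b) := by
  cases b
  · exact Sym2.eq_swap
  · rfl

/-- The graph drawn by a configuration. -/
def configGraph (a : I → Bool → V) : SimpleGraph V := .fromEdgeSet (Set.range (edge a))

/-- The configuration is a noncrossing spanning tree. -/
structure IsPlane (a : I → Bool → V) : Prop where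
  connected : (configGraph a).Connected
  nonCross : ∀ k l, X.NonCross (edge a k) (edge a l)

/-- A connected graph on `V` needs at least `|V| - 1` edges, and there are only that many labels.
This turns equality of segments into equality of labels. -/
theorem edge_injective [Fintype I] [Fintype V] {a : I → Bool → V}
    (h : (configGraph a).Connected) (hcard : Fintype.card I + 1 = Fintype.card V) :
    Function.Injective (edge a) := by
  classical
  have h1 := h.card_vert_le_card_edgeSet_add_one
  rw [Nat.card_eq_fintype_card, ← hcard] at h1
  have h2 : (configGraph a).edgeSet ⊆ Set.range (edge a) := by
    simp [configGraph]
  have h3 : Nat.card (configGraph a).edgeSet ≤ Nat.card (Set.range (edge a)) :=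
    Nat.card_mono (Set.finite_range _) h2
  have h4 : Fintype.card I ≤ (Finset.univ.image (edge a)).card := by
    rw [← Set.ncard_coe_finset, Finset.coe_image, Finset.coe_univ, Set.image_univ]
    exact (Nat.le_of_add_le_add_right h1).trans h3
  have h5 := Finset.card_image_iff.1 (le_antisymm Finset.card_image_le h4)
  rwa [Finset.coe_univ, Set.injOn_univ] at h5

/-- A move: the end `b` of label `i` slides along label `j` from its end `c` to the other end; `s`
tells the side on which this happens. -/
structure Move (I : Type*) where
  i : I
  b : Bool
  j : I
  c : Bool
  s : Bool

/-- The configuration after a move. -/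
def Move.app [DecidableEq I] (o : Move I) (a : I → Bool → V) : I → Bool → V :=
  Function.update a o.i (Function.update (a o.i) o.b (a o.j (!o.c)))

/-- The geometric conditions under which a move is an edge slide. -/
structure Move.Enabled (o : Move I) (a : I → Bool → V) : Prop where
  ne : o.i ≠ o.j
  base : a o.i o.b = a o.j o.c
  side_ne : X.χ (a o.i !o.b) (a o.i o.b) (a o.j !o.c) ≠ 0
  side : 0 < X.χ (a o.i !o.b) (a o.i o.b) (a o.j !o.c) ↔ o.s = true
  nonCross : ∀ k, X.NonCross (edge a k) s(a o.i !o.b, a o.j !o.c)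

/-- A step from a noncrossing spanning tree by an enabled move. -/
def Step [DecidableEq I] (o : Move I) (a a' : I → Bool → V) : Prop :=
  IsPlane X a ∧ o.Enabled X a ∧ a' = o.app a

/-- The event which label `k` experiences in a move. -/
def Move.event [DecidableEq I] (o : Move I) (k : I) : Option (Bool × Bool × Bool) :=
  if k = o.i then some (true, o.b, o.s) else if k = o.j then some (false, o.c, o.s) else none

variable {X}

theorem Move.Enabled.edge_i {o : Move I} {a : I → Bool → V} :
    edge a o.i = s(a o.i !o.b, a o.i o.b) := edge_eq a o.i o.b

theorem Move.Enabled.edge_j {o : Move I} {a : I → Bool → V} (h : o.Enabled X a) :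
    edge a o.j = s(a o.i o.b, a o.j !o.c) := by
  rw [edge_eq _ _ (!o.c), Bool.not_not, h.base]

variable [DecidableEq I]

theorem Move.app_of_ne (o : Move I) (a : I → Bool → V) {k : I} (h : k ≠ o.i) :
    o.app a k = a k := by
  simp [Move.app, h]

theorem edge_app_of_ne (o : Move I) (a : I → Bool → V) {k : I} (h : k ≠ o.i) :
    edge (o.app a) k = edge a k := by
  simp [edge, o.app_of_ne a h]

theorem edge_app_self (o : Move I) (a : I → Bool → V) :
    edge (o.app a) o.i = s(a o.i !o.b, a o.j !o.c) := by
  rw [edge_eq _ _ o.b]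
  simp [Move.app]

/-- The lost edge is replaced by a detour through the new edge and the base. -/
theorem connected_app {o : Move I} {a : I → Bool → V} (h : o.Enabled X a)
    (hc : (configGraph a).Connected) : (configGraph (o.app a)).Connected := by
  have hreach : ∀ k x y, edge a k = s(x, y) → k ≠ o.i → (configGraph (o.app a)).Reachable x y := by
    intro k x y hxy hk
    by_cases hne : x = y
    · rw [hne]
    · refine SimpleGraph.Adj.reachable ?_
      rw [configGraph, SimpleGraph.fromEdgeSet_adj]
      exact ⟨⟨k, by rw [edge_app_of_ne _ _ hk, hxy]⟩, hne⟩
  have hj := hreach o.j _ _ h.edge_j h.ne.symm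
  have hp : (configGraph (o.app a)).Reachable (a o.i !o.b) (a o.j !o.c) := by
    by_cases hne : a o.i (!o.b) = a o.j (!o.c)
    · rw [hne]
    · refine SimpleGraph.Adj.reachable ?_
      rw [configGraph, SimpleGraph.fromEdgeSet_adj]
      exact ⟨⟨o.i, edge_app_self o a⟩, hne⟩
  have hi := hp.trans hj.symm
  have := hc.nonempty
  refine ⟨fun x y => ?_⟩
  obtain ⟨w⟩ := hc.preconnected x y
  induction w with
  | nil => rfl
  | @cons u v _ hadj _ ih =>
    refine SimpleGraph.Reachable.trans ?_ ih
    rw [configGraph, SimpleGraph.fromEdgeSet_adj] at hadj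
    obtain ⟨⟨k, hk⟩, -⟩ := hadj
    by_cases hki : k = o.i
    · rw [hki, Move.Enabled.edge_i, Sym2.eq_iff] at hk
      rcases hk with ⟨rfl, rfl⟩ | ⟨rfl, rfl⟩
      · exact hi
      · exact hi.symm
    · exact hreach k u v hk hki

theorem isPlane_app {o : Move I} {a : I → Bool → V} (h : o.Enabled X a)
    (ha : IsPlane X a) : IsPlane X (o.app a) := by
  refine ⟨connected_app h ha.connected, fun k l => ?_⟩
  by_cases hk : k = o.i <;> by_cases hl : l = o.i
  · rw [hk, hl, edge_app_self]
    exact nonCross_of_common _ _ _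
  · rw [hk, edge_app_self, edge_app_of_ne _ _ hl]
    exact (h.nonCross l).symm
  · rw [hl, edge_app_self, edge_app_of_ne _ _ hk]
    exact h.nonCross k
  · rw [edge_app_of_ne _ _ hl, edge_app_of_ne _ _ hk]
    exact ha.nonCross k l

theorem Move.event_eq_none {o : Move I} {k : I} (h : o.event k = none) : k ≠ o.i ∧ k ≠ o.j := by
  unfold Move.event at h
  split_ifs at h with h1 h2
  exact ⟨h1, h2⟩

theorem Move.independent {o o' : Move I} (h : Independent Move.event o o') :
    o.i ≠ o'.i ∧ o.i ≠ o'.j ∧ o.j ≠ o'.i ∧ o.j ≠ o'.j := by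
  have hi := Move.event_eq_none ((h o.i).resolve_left (by simp [Move.event]))
  have hj := Move.event_eq_none ((h o.j).resolve_left (by unfold Move.event; split_ifs <;> simp_all))
  exact ⟨hi.1, hi.2, hj.1, hj.2⟩

/-- After an independent move only the noncrossing condition has to be checked anew. -/
theorem Move.enabled_app_iff {o o' : Move I} {a : I → Bool → V}
    (h : Independent Move.event o o') : o.Enabled X (o'.app a) ↔
      o.i ≠ o.j ∧ a o.i o.b = a o.j o.c ∧ X.χ (a o.i !o.b) (a o.i o.b) (a o.j !o.c) ≠ 0 ∧
      (0 < X.χ (a o.i !o.b) (a o.i o.b) (a o.j !o.c) ↔ o.s = true) ∧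
      ∀ k, X.NonCross (edge (o'.app a) k) s(a o.i !o.b, a o.j !o.c) := by
  obtain ⟨h1, -, h3, -⟩ := Move.independent h
  have e1 := o'.app_of_ne a h1
  have e2 := o'.app_of_ne a h3
  constructor
  · rintro ⟨p1, p2, p3, p4, p5⟩
    rw [e1, e2] at *
    exact ⟨p1, p2, p3, p4, p5⟩
  · rintro ⟨p1, p2, p3, p4, p5⟩
    rw [← e1, ← e2] at p2 p3 p4 p5
    exact ⟨p1, p2, p3, p4, p5⟩

theorem Move.app_comm {o o' : Move I} (a : I → Bool → V)
    (h : Independent Move.event o o') : o.app (o'.app a) = o'.app (o.app a) := by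
  obtain ⟨h1, h2, h3, -⟩ := Move.independent h
  have e1 := o'.app_of_ne a h1
  have e2 := o'.app_of_ne a h3
  have e3 := o.app_of_ne a h1.symm
  have e4 := o.app_of_ne a h2.symm
  rw [Move.app, e1, e2, Move.app.eq_1 o' (o.app a), e3, e4, Move.app, Move.app,
    Function.update_comm h1]

variable [Fintype I] [Fintype V]

/-- The role flag in the event leaves two cases: `k` slides in both moves, or `k` is the base of
both. Either way the two triangles lie on the same side of `k` and turn about the same end, so
`eq_of_same_sign` identifies their third vertices. -/
theorem Move.Enabled.eq_of_event {o o' : Move I} {a : I → Bool → V} {k : I}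
    {γ : Bool × Bool × Bool} (hcard : Fintype.card I + 1 = Fintype.card V) (ha : IsPlane X a)
    (h : o.Enabled X a) (h' : o'.Enabled X a) (e : o.event k = some γ)
    (e' : o'.event k = some γ) : o = o' := by
  have hinj := edge_injective ha.connected hcard
  obtain ⟨i, b, j, c, s⟩ := o
  obtain ⟨i', b', j', c', s'⟩ := o'
  have hij := h.ne
  have hij' := h'.ne
  have hdiag : ∀ l, ∀ d d' : Bool, a l d = a l d' → a l d ≠ a l (!d) → d = d' := by
    intro l d d' h1 h2
    cases d <;> cases d' <;> simp_all
  have hloop : ∀ {o : Move I}, o.Enabled X a → a o.j o.c ≠ a o.j !o.c := by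
    intro o h he
    have := h.side_ne
    rw [h.base, he, X.self_right] at this
    exact this rfl
  have hloop' : ∀ {o : Move I}, o.Enabled X a → a o.i o.b ≠ a o.i !o.b := by
    intro o h he
    have := h.side_ne
    rw [he, X.self_left] at this
    exact this rfl
  unfold Move.event at e e'
  dsimp only at e e' hij hij'
  split_ifs at e e' with h1 h2 h3 h4 h5 h6
  · subst h1
    subst h2
    simp only [Option.some.injEq] at e e'
    obtain rfl := e'
    simp only [Prod.mk.injEq, true_and] at e
    obtain ⟨rfl, rfl⟩ := e
    have hr : a j (!c) = a j' (!c') := by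
      refine eq_of_same_sign h.side_ne h'.side_ne (h.side.trans h'.side.symm) ?_ ?_
      · have := h'.nonCross j
        rwa [h.edge_j] at this
      · have := h.nonCross j'
        rwa [h'.edge_j] at this
    obtain rfl : j = j' := hinj (by rw [h.edge_j, h'.edge_j, hr])
    have := hdiag j c c' (by have := h.base; have := h'.base; simp_all) (hloop h)
    subst this
    rfl
  · cases e.trans e'.symm
  · cases e.trans e'.symm
  · subst h4
    subst h6
    simp only [Option.some.injEq] at e e'
    obtain rfl := e'
    simp only [Prod.mk.injEq, true_and] at e
    obtain ⟨rfl, rfl⟩ := e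
    have hq : a i b = a i' b' := h.base.trans h'.base.symm
    have hp : a i (!b) = a i' (!b') := by
      have hc (p q r : V) : X.mirror.χ r q p = X.χ p q r := by
        rw [X.cyc p q r, X.swap q r p]
        rfl
      -- The triangle is now read from the base, with the outer vertices exchanged; this reverses
      -- its orientation, and the mirror image restores it.
      refine eq_of_same_sign (X := X.mirror) (p := a k !c) (q := a i b) ?_ ?_ ?_ ?_ ?_
      · rw [hc]
        exact h.side_ne
      · rw [hc, hq]
        exact h'.side_ne
      · have h2 := h'.side
        dsimp only at h2
        rw [← hq] at h2
        rw [hc, hc]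
        exact h.side.trans h2.symm
      · have := h'.nonCross i
        rw [edge_eq a i (!b), Bool.not_not, Sym2.eq_swap (b := a k !c)] at this
        exact this.mirror
      · have := h.nonCross i'
        rw [edge_eq a i' (!b'), Bool.not_not, Sym2.eq_swap (b := a k !c), ← hq] at this
        exact this.mirror
    obtain rfl : i = i' := hinj (by rw [edge_eq a i b, edge_eq a i' b', hp, hq])
    have := hdiag i b b' hq (hloop' h)
    subst this
    rfl

/-- For independent moves a single pair of segments has to be checked anew. All other pairs of sides
of the two triangles are known not to cross, and distinct labels exclude a common side, so
`nonCross_of_triangles` applies. -/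
theorem isLocal_step (hcard : Fintype.card I + 1 = Fintype.card V) :
    IsLocal (Step (I := I) X) Move.event where
  det h h' := h.2.2.trans h'.2.2.symm
  active o := ⟨o.i, _, if_pos rfl⟩
  unique h h' e e' := h.2.1.eq_of_event hcard h.1 h'.2.1 e e'
  swap := by
    rintro o o' x y z hind ⟨hx, ho, rfl⟩ ⟨hy, ho', rfl⟩
    have hind' : Independent Move.event o' o := fun k => (hind k).symm
    obtain ⟨n1, n2, n3, n4⟩ := Move.independent hind
    have hinj := edge_injective hy.connected hcard
    obtain ⟨p1, p2, p3, p4, p5⟩ := (Move.enabled_app_iff hind').1 ho'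
    -- The segment of `x` that is missing after `o` is the old edge of `o`; the new edge of `o'`
    -- must be shown not to cross it.
    have h' : o'.Enabled X x := by
      refine ⟨p1, p2, p3, p4, fun k => ?_⟩
      by_cases hk : k = o.i
      · have hi := edge_app_self o x
        have hj : edge (o.app x) o.j = s(x o.i o.b, x o.j !o.c) := by
          rw [edge_app_of_ne _ _ ho.ne.symm, ho.edge_j]
        have hi' : edge x o'.i = _ := edge_eq x o'.i o'.b
        have hj' : edge x o'.j = s(x o'.j !o'.c, x o'.i o'.b) := by
          rw [edge_eq x o'.j o'.c, p2]
        have ei := edge_app_of_ne o x n1.symm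
        have ej := edge_app_of_ne o x n2.symm
        rw [hk, edge_eq x o.i o.b]
        apply nonCross_of_triangles (c := x o.j !o.c) (c' := x o'.i o'.b)
        · rw [← hi]
          exact p5 _
        · rw [← hj]
          exact p5 _
        · rw [← hi', ← edge_eq]
          exact hx.nonCross _ _
        · rw [← hj', ← edge_eq]
          exact hx.nonCross _ _
        · rw [← hi, ← hi', ← ei]
          exact hinj.ne n1
        · rw [← hi, ← hj', ← ej]
          exact hinj.ne n2
        · rw [← hj, ← hi', ← ei]
          exact hinj.ne n3
        · rw [← hj, ← hj', ← ej]
          exact hinj.ne n4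
      · have := p5 k
        rwa [edge_app_of_ne _ _ hk] at this
    refine ⟨o'.app x, ⟨hx, h', rfl⟩, isPlane_app h' hx, ?_, Move.app_comm x hind'⟩
    rw [Move.enabled_app_iff hind]
    refine ⟨ho.ne, ho.base, ho.side_ne, ho.side, fun k => ?_⟩
    by_cases hk : k = o'.i
    · have := p5 o.i
      rw [edge_app_self] at this
      rw [hk, edge_app_self]
      exact this.symm
    · rw [edge_app_of_ne _ _ hk]
      exact ho.nonCross k
  persist := by
    rintro o o' x y z hind ⟨hx, ho, rfl⟩ ⟨-, ho', rfl⟩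
    obtain ⟨n1, n2, n3, n4⟩ := Move.independent hind
    have hinj := edge_injective hx.connected hcard
    refine ⟨_, isPlane_app ho' hx, ?_, rfl⟩
    rw [Move.enabled_app_iff hind]
    refine ⟨ho.ne, ho.base, ho.side_ne, ho.side, fun k => ?_⟩
    by_cases hk : k = o'.i
    -- Here the critical pair consists of the two new edges.
    · have hi : edge x o.i = _ := edge_eq x o.i o.b
      have hj : edge x o.j = s(x o.j !o.c, x o.i o.b) := by rw [ho.edge_j, Sym2.eq_swap]
      have hi' : edge x o'.i = _ := edge_eq x o'.i o'.b
      have hj' : edge x o'.j = s(x o'.j !o'.c, x o'.i o'.b) := by rw [ho'.edge_j, Sym2.eq_swap]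
      rw [hk, edge_app_self]
      apply nonCross_of_triangles (c := x o'.i o'.b) (c' := x o.i o.b)
      · rw [← hi']
        exact ho.nonCross _
      · rw [← hj']
        exact ho.nonCross _
      · rw [← hi]
        exact (ho'.nonCross _).symm
      · rw [← hj]
        exact (ho'.nonCross _).symm
      · rw [← hi, ← hi']
        exact hinj.ne n1.symm
      · rw [← hj, ← hi']
        exact hinj.ne n3.symm
      · rw [← hi, ← hj']
        exact hinj.ne n2.symm
      · rw [← hj, ← hj']
        exact hinj.ne n4.symm
    · rw [edge_app_of_ne _ _ hk]
      exact ho.nonCross k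

theorem Move.sum_event_length_le (o : Move I) : ∑ k, (o.event k).toList.length ≤ 2 := by
  have : ∀ k, (o.event k).toList.length ≤ (if k = o.i then 1 else 0) + (if k = o.j then 1 else 0) := by
    intro k
    unfold Move.event
    split_ifs <;> simp
  refine (Finset.sum_le_sum fun k _ => this k).trans ?_
  simp [Finset.sum_add_distrib]

end Chirotope

end EdgeSlideBound

namespace EdgeSlideBound

/-! ### Points in convex position form a chirotope -/

section Geometry

/-- Twice the signed area of a triangle. -/
def orient (a b c : Plane) : ℝ := (b 0 - a 0) * (c 1 - a 1) - (b 1 - a 1) * (c 0 - a 0)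

theorem orient_combo (a b c d : Plane) (t : ℝ) :
    orient a b ((1 - t) • c + t • d) = (1 - t) * orient a b c + t * orient a b d := by
  simp only [orient, PiLp.add_apply, PiLp.smul_apply, smul_eq_mul]
  ring

theorem orient_self_left (a c : Plane) : orient a a c = 0 := by simp [orient]

theorem orient_self_right (a b : Plane) : orient a b b = 0 := by simp only [orient]; ring

theorem orient_self_outer (a b : Plane) : orient a b a = 0 := by simp [orient]

theorem exists_combo_of_orient_eq_zero {a b y : Plane} (hab : a ≠ b) (h : orient a b y = 0) :
    ∃ t : ℝ, y = (1 - t) • a + t • b := by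
  set u := b 0 - a 0 with hu
  set v := b 1 - a 1 with hv
  have huv : u ^ 2 + v ^ 2 ≠ 0 := by
    intro h0
    apply hab
    have h1 : u = 0 := by nlinarith [sq_nonneg u, sq_nonneg v]
    have h2 : v = 0 := by nlinarith [sq_nonneg u, sq_nonneg v]
    ext i
    fin_cases i
    · exact (sub_eq_zero.1 h1).symm
    · exact (sub_eq_zero.1 h2).symm
  have h' : u * (y 1 - a 1) = v * (y 0 - a 0) := sub_eq_zero.1 h
  refine ⟨(u * (y 0 - a 0) + v * (y 1 - a 1)) / (u ^ 2 + v ^ 2), ?_⟩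
  set t := (u * (y 0 - a 0) + v * (y 1 - a 1)) / (u ^ 2 + v ^ 2) with ht
  have ht' : t * (u ^ 2 + v ^ 2) = u * (y 0 - a 0) + v * (y 1 - a 1) := div_mul_cancel₀ _ huv
  have e0 : t * u = y 0 - a 0 := by
    apply mul_right_cancel₀ huv
    linear_combination u * ht' + v * h'
  have e1 : t * v = y 1 - a 1 := by
    apply mul_right_cancel₀ huv
    linear_combination v * ht' - u * h'
  ext i
  fin_cases i
  · simp only [Fin.zero_eta, PiLp.add_apply, PiLp.smul_apply, smul_eq_mul]
    linear_combination -e0 - t * hu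
  · simp only [Fin.mk_one, PiLp.add_apply, PiLp.smul_apply, smul_eq_mul]
    linear_combination -e1 - t * hv

variable {S : Finset Plane}

/-- The form in which convex position is used; weights may vanish and points may repeat, so segments
are covered too. -/
theorem eq_of_convex_combo (hS : InConvexPosition S) {x b c d : S} {β γ δ : ℝ} (hβ : 0 ≤ β)
    (hγ : 0 ≤ γ) (hδ : 0 ≤ δ) (h1 : β + γ + δ = 1)
    (hx : (x : Plane) = β • (b : Plane) + γ • (c : Plane) + δ • (d : Plane)) :
    x = b ∨ x = c ∨ x = d := by
  have := hS {b, c, d} x (by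
    have hmem : ∀ y ∈ ({b, c, d} : Set S),
        (y : Plane) ∈ convexHull ℝ ((fun x : S => (x : Plane)) '' {b, c, d}) :=
      fun y hy => subset_convexHull ℝ _ ⟨y, hy, rfl⟩
    have hsum := (convex_convexHull ℝ ((fun x : S => (x : Plane)) '' {b, c, d})).sum_mem
      (t := Finset.univ) (w := ![β, γ, δ]) (z := ![(b : Plane), c, d])
      (by intro i _; fin_cases i <;> simpa) (by simpa [Fin.sum_univ_three] using h1)
      (by intro i _; fin_cases i <;> exact hmem _ (by simp))
    simpa [Fin.sum_univ_three, hx] using hsum)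
  simpa using this

theorem orient_ne_zero (hS : InConvexPosition S) {a b c : S} (hab : a ≠ b) (hbc : b ≠ c)
    (hac : a ≠ c) : orient a b c ≠ 0 := by
  intro h
  obtain ⟨t, ht⟩ := exists_combo_of_orient_eq_zero (fun h => hab (Subtype.ext h)) h
  -- According to the position of `t` relative to 0 and 1, the middle one of the three collinear
  -- points is a convex combination of the others.
  rcases le_total t 0 with h0 | h0
  · have hpos : 0 < 1 - t := by linarith
    have hx : (a : Plane) = (1 / (1 - t)) • (c : Plane) + (-t / (1 - t)) • (b : Plane)
        + (0 : ℝ) • (b : Plane) := by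
      rw [ht]
      match_scalars <;> field_simp
      ring
    have := eq_of_convex_combo hS (by positivity) (div_nonneg (by linarith) hpos.le) le_rfl
      (by field_simp; ring) hx
    tauto
  rcases le_total t 1 with h1 | h1
  · have hx : (c : Plane) = (1 - t) • (a : Plane) + t • (b : Plane)
        + (0 : ℝ) • (b : Plane) := by
      rw [ht]
      simp
    have := eq_of_convex_combo hS (by linarith) h0 le_rfl (by ring) hx
    have := hac.symm
    have := hbc.symm
    tauto
  · have hpos : 0 < t := by linarith
    have hx : (b : Plane) = (1 / t) • (c : Plane) + ((t - 1) / t) • (a : Plane)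
        + (0 : ℝ) • (a : Plane) := by
      rw [ht]
      match_scalars <;> field_simp
      ring
    have := eq_of_convex_combo hS (by positivity) (div_nonneg (by linarith) hpos.le) le_rfl
      (by field_simp; ring) hx
    have := hab.symm
    tauto

theorem distinct_of_orient_mul_neg {a b c d : S} (h : orient a b c * orient a b d < 0) :
    a ≠ b ∧ a ≠ c ∧ a ≠ d ∧ b ≠ c ∧ b ≠ d ∧ c ≠ d := by
  refine ⟨?_, ?_, ?_, ?_, ?_, ?_⟩ <;> rintro rfl
  case refine_6 => exact absurd h (not_lt.2 (mul_self_nonneg _))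
  all_goals
    simp only [orient_self_left, orient_self_right, orient_self_outer, mul_zero, zero_mul,
      lt_self_iff_false] at h

/-- In convex position, if `c` and `d` lie on different sides of `ab`, the chords `ab` and `cd`
cross properly. -/
theorem exists_crossing (hS : InConvexPosition S) {a b c d : S}
    (h : orient a b c * orient a b d < 0) :
    ∃ s t : ℝ, 0 < s ∧ s < 1 ∧ 0 < t ∧ t < 1 ∧
      (1 - s) • (c : Plane) + s • (d : Plane) = (1 - t) • (a : Plane) + t • (b : Plane) := by
  obtain ⟨hab, hac, had, hbc, hbd, -⟩ := distinct_of_orient_mul_neg h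
  obtain ⟨s, hs0, hs1, hs⟩ : ∃ s : ℝ, 0 < s ∧ s < 1 ∧
      (1 - s) * orient a b c + s * orient a b d = 0 := by
    set p := orient (a : Plane) b c
    set q := orient (a : Plane) b d
    have hpq : p - q ≠ 0 := by
      intro h0
      rw [sub_eq_zero.1 h0] at h
      exact absurd h (not_lt.2 (mul_self_nonneg _))
    refine ⟨p / (p - q), ?_, ?_, ?_⟩
    · rcases mul_neg_iff.1 h with ⟨hp, hq⟩ | ⟨hp, hq⟩
      · exact div_pos hp (by linarith)
      · exact div_pos_of_neg_of_neg hp (by linarith)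
    · rcases mul_neg_iff.1 h with ⟨hp, hq⟩ | ⟨hp, hq⟩
      · rw [div_lt_one (by linarith)]; linarith
      · rw [div_lt_one_of_neg (by linarith)]; linarith
    · field_simp
      ring
  rw [← orient_combo] at hs
  obtain ⟨t, ht⟩ := exists_combo_of_orient_eq_zero (fun h => hab (Subtype.ext h)) hs
  refine ⟨s, t, hs0, hs1, ?_, ?_, ht⟩
  -- If the line `ab` met the segment `cd` at or beyond `a`, then `a` would lie in the triangle
  -- `bcd`; the bound at `b` is symmetric.
  · by_contra! h0
    have hpos : 0 < 1 - t := by linarith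
    have hx : (a : Plane) = (-t / (1 - t)) • (b : Plane) + ((1 - s) / (1 - t)) • (c : Plane)
        + (s / (1 - t)) • (d : Plane) := by
      have : (a : Plane) = (1 / (1 - t)) • ((1 - t) • (a : Plane) + t • (b : Plane))
          + (-t / (1 - t)) • (b : Plane) := by
        match_scalars <;> field_simp
        ring
      rw [this, ← ht]
      match_scalars <;> field_simp
    have := eq_of_convex_combo hS (div_nonneg (by linarith) hpos.le)
      (div_nonneg (by linarith) hpos.le) (div_nonneg hs0.le hpos.le) (by field_simp; ring) hx
    tauto
  · by_contra! h0
    have hpos : 0 < t := by linarith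
    have hx : (b : Plane) = ((t - 1) / t) • (a : Plane) + ((1 - s) / t) • (c : Plane)
        + (s / t) • (d : Plane) := by
      have : (b : Plane) = (1 / t) • ((1 - t) • (a : Plane) + t • (b : Plane))
          + ((t - 1) / t) • (a : Plane) := by
        match_scalars <;> field_simp
        ring
      rw [this, ← ht]
      match_scalars <;> field_simp
    have := eq_of_convex_combo hS (div_nonneg (by linarith) hpos.le)
      (div_nonneg (by linarith) hpos.le) (div_nonneg hs0.le hpos.le) (by field_simp; ring) hx
    have := hab.symm
    tauto

/-- The orientations of the triples of a point set in convex position. -/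
def chirotope (hS : InConvexPosition S) : Chirotope S where
  χ a b c := orient a b c
  cyc a b c := by simp only [orient]; ring
  swap a b c := by simp only [orient]; ring
  ne_zero h1 h2 h3 := orient_ne_zero hS h1 h2 h3
  cross_symm {a b c d} h := by
    obtain ⟨s, t, hs0, hs1, ht0, ht1, hst⟩ := exists_crossing hS h
    obtain ⟨-, hac, had, -, -, hcd⟩ := distinct_of_orient_mul_neg h
    have hne := orient_ne_zero hS hcd had.symm hac.symm
    have h0 : orient (c : Plane) d ((1 - s) • (c : Plane) + s • (d : Plane)) = 0 := by
      rw [orient_combo, orient_self_outer, orient_self_right]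
      simp
    rw [hst, orient_combo] at h0
    have hsq : 0 < orient (c : Plane) d a ^ 2 := by positivity
    by_contra! hle
    have h1 : 0 ≤ t * (orient (c : Plane) d a * orient (c : Plane) d b) :=
      mul_nonneg ht0.le hle
    have h2 : 0 < (1 - t) * orient (c : Plane) d a ^ 2 := mul_pos (by linarith) hsq
    -- The crossing point lies on `cd`, so its orientation vanishes; multiplying that relation by
    -- the orientation of `c d a` produces a square and the product in question.
    have h3 : (1 - t) * orient (c : Plane) d a ^ 2 +
        t * (orient (c : Plane) d a * orient (c : Plane) d b) = 0 := by
      linear_combination orient (c : Plane) d a * h0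
    linarith

theorem combo_mem_edgeSegment (a b : S) {t : ℝ} (h0 : 0 ≤ t) (h1 : t ≤ 1) :
    (1 - t) • (a : Plane) + t • (b : Plane) ∈ edgeSegment s(a, b) :=
  convex_convexHull ℝ _ (subset_convexHull ℝ _ (Set.mem_image_of_mem _ (by simp)))
    (subset_convexHull ℝ _ (Set.mem_image_of_mem _ (by simp))) (by linarith) h0 (by ring)

/-- Opposite orientations would give a common point of the two segments, while their four ends are
distinct. -/
theorem nonCross_of_noncrossing (hS : InConvexPosition S) {E : Set (Sym2 S)}
    (hE : Noncrossing E) {e f : Sym2 S} (he : e ∈ E) (hf : f ∈ E) :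
    (chirotope hS).NonCross e f := by
  rintro a b c d rfl rfl
  by_contra! h
  obtain ⟨s, t, hs0, hs1, ht0, ht1, hst⟩ := exists_crossing hS h
  obtain ⟨-, hac, had, hbc, hbd, -⟩ := distinct_of_orient_mul_neg h
  have hne : s(a, b) ≠ s(c, d) := by
    rw [Ne, Sym2.eq_iff]
    tauto
  obtain ⟨v, -, hv, hv'⟩ := hE _ he _ hf hne _
    ⟨combo_mem_edgeSegment a b ht0.le ht1.le, hst ▸ combo_mem_edgeSegment c d hs0.le hs1.le⟩
  rw [Sym2.mem_iff] at hv hv'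
  rcases hv with rfl | rfl <;> tauto

end Geometry

/-! ### From labeled trees to configurations -/

section Trees

variable {S : Finset Plane}

/-- The configuration `a` lists the ends of the edges of `T` by labels. -/
def Represents (a : Fin (S.card - 1) → Bool → S) (T : LabeledPlaneTree S) : Prop :=
  ∀ k, edge a k = (T.label.symm k : Sym2 S)

theorem exists_represents (T : LabeledPlaneTree S) : ∃ a, Represents a T := by
  have : ∀ k, ∃ v : Bool → S, s(v false, v true) = (T.label.symm k : Sym2 S) := by
    intro k
    generalize (T.label.symm k : Sym2 S) = e
    induction e using Sym2.ind with
    | _ x y => exact ⟨fun b => cond b y x, rfl⟩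
  choose a ha using this
  exact ⟨a, ha⟩

theorem label_symm_eq {T : LabeledPlaneTree S} {e : Sym2 S} (h : e ∈ T.graph.edgeSet)
    {k : Fin (S.card - 1)} (hk : T.label ⟨e, h⟩ = k) : (T.label.symm k : Sym2 S) = e := by
  rw [← hk, Equiv.symm_apply_apply]

theorem range_label_symm (T : LabeledPlaneTree S) :
    Set.range (fun k => (T.label.symm k : Sym2 S)) = T.graph.edgeSet := by
  ext e
  exact ⟨fun ⟨k, hk⟩ => hk ▸ (T.label.symm k).2, fun h => ⟨_, label_symm_eq h rfl⟩⟩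

theorem tree_ext {T T' : LabeledPlaneTree S}
    (h : ∀ k, (T.label.symm k : Sym2 S) = T'.label.symm k) : T = T' := by
  have hg : T.graph = T'.graph := by
    apply SimpleGraph.edgeSet_injective
    exact (range_label_symm T).symm.trans ((congrArg Set.range (funext h)).trans (range_label_symm T'))
  obtain ⟨G, ht, hn, l⟩ := T
  obtain ⟨G', ht', hn', l'⟩ := T'
  obtain rfl : G = G' := hg
  have : l.symm = l'.symm := Equiv.ext fun k => Subtype.ext (h k)
  obtain rfl : l = l' := by rw [← l.symm_symm, this, l'.symm_symm]
  rfl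

variable {hS : InConvexPosition S} {T T' : LabeledPlaneTree S} {a : Fin (S.card - 1) → Bool → S}

theorem Represents.isPlane (h : Represents a T) : IsPlane (chirotope hS) a := by
  have hr : ∀ k, edge a k ∈ T.graph.edgeSet := fun k => h k ▸ (T.label.symm k).2
  refine ⟨?_, fun k l => nonCross_of_noncrossing hS T.noncrossing (hr k) (hr l)⟩
  have : configGraph a = T.graph := by
    rw [configGraph, show edge a = _ from funext h, range_label_symm,
      SimpleGraph.fromEdgeSet_edgeSet]
  rw [this]
  exact T.isTree.connected

/-- An edge slide is an enabled move. -/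
theorem Represents.exists_move (h : Represents a T) {E : Set (Sym2 S)} {e₁ e₂ : Sym2 S}
    (h₁ : e₁ ∈ T.graph.edgeSet) (h₁' : e₁ ∉ E) (h₂ : ¬ e₂.IsDiag)
    (hs : SlideCondition T.graph.edgeSet E e₁ e₂) :
    ∃ o : Move (Fin (S.card - 1)), o.Enabled (chirotope hS) a ∧ o.i = T.label ⟨e₁, h₁⟩ ∧
      s(a o.i !o.b, a o.j !o.c) = e₂ := by
  obtain ⟨p, q, r, rfl, rfl, hn, -, -, hqr, hqr'⟩ := hs
  have hpq : p ≠ q := SimpleGraph.Adj.ne h₁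
  have hqr₀ : q ≠ r := SimpleGraph.Adj.ne hqr
  have hpr : p ≠ r := by simpa using h₂
  have hends : ∀ k x y, edge a k = s(x, y) → ∃ b, a k (!b) = x ∧ a k b = y := by
    intro k x y hk
    rw [edge, Sym2.eq_iff] at hk
    rcases hk with ⟨h1, h2⟩ | ⟨h1, h2⟩
    · exact ⟨true, h1, h2⟩
    · exact ⟨false, h2, h1⟩
  obtain ⟨b, hp, hq⟩ := hends (T.label ⟨_, h₁⟩) p q (by rw [h, Equiv.symm_apply_apply])
  obtain ⟨c, hr, hq'⟩ := hends (T.label ⟨_, hqr⟩) r q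
    (by rw [h, Equiv.symm_apply_apply]; exact Sym2.eq_swap)
  refine ⟨⟨T.label ⟨_, h₁⟩, b, T.label ⟨_, hqr⟩, c, decide (0 < (chirotope hS).χ p q r)⟩,
    ⟨?_, ?_, ?_, ?_, ?_⟩, rfl, ?_⟩ <;> dsimp only
  · intro hij
    have : s(p, q) = s(q, r) := congrArg Subtype.val (T.label.injective hij)
    rw [this] at h₁'
    exact h₁' hqr'
  · rw [hq, hq']
  · rw [hp, hq, hr]
    exact (chirotope hS).ne_zero hpq hqr₀ hpr
  · rw [hp, hq, hr, decide_eq_true_iff]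
  · intro k
    rw [hp, hr]
    exact nonCross_of_noncrossing hS hn (Or.inl (h k ▸ (T.label.symm k).2)) (Or.inr rfl)
  · rw [hp, hr]

theorem Represents.exists_step (h : Represents a T) (hs : EdgeSlide T T') :
    ∃ o a', Step (chirotope hS) o a a' ∧ Represents a' T' := by
  obtain ⟨e₁, e₂, h₁, h₂, hd₁, hd₂, hc, hl, hk⟩ := hs
  have h₁' : e₁ ∉ T'.graph.edgeSet := (hd₁.symm ▸ rfl : e₁ ∈ T.graph.edgeSet \ _).2
  obtain ⟨o, ho, hi, he⟩ := h.exists_move (hS := hS) h₁ h₁'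
    (T'.graph.not_isDiag_of_mem_edgeSet h₂) hc
  refine ⟨o, _, ⟨h.isPlane, ho, rfl⟩, fun k => ?_⟩
  by_cases hki : k = o.i
  · rw [hki, edge_app_self, he, hi, label_symm_eq h₂ hl]
  · rw [edge_app_of_ne _ _ hki, h k]
    have hmem := (T.label.symm k).2
    have hmem' : (T.label.symm k : Sym2 S) ∈ T'.graph.edgeSet := by
      by_contra hn
      have : (T.label.symm k : Sym2 S) = e₁ := hd₁.subset ⟨hmem, hn⟩
      apply hki
      rw [hi, ← T.label.apply_symm_apply k]
      exact congrArg _ (Subtype.ext this)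
    refine (label_symm_eq hmem' ?_).symm
    rw [← hk _ hmem hmem']
    exact T.label.apply_symm_apply k

theorem Represents.exists_run (h : Represents a T) {m : ℕ} (hm : TransformsIn EdgeSlide m T T') :
    ∃ w a', w.length = m ∧ Run (Step (chirotope hS)) w a a' ∧ Represents a' T' := by
  obtain ⟨t, rfl, rfl, ht⟩ := hm
  induction m generalizing t a with
  | zero => exact ⟨[], a, rfl, .nil a, h⟩
  | succ m ih =>
    obtain ⟨o, a', ho, ha'⟩ := h.exists_step (hS := hS) (ht 0 m.succ_pos)
    obtain ⟨w, a'', hw, hrun, hr⟩ := ih (fun s => t (s + 1)) ha' fun i hi => ht (i + 1) (by omega)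
    exact ⟨o :: w, a'', by simp [hw], .cons ho hrun, hr⟩

/-- The same tree with permuted labels. -/
def relabel (T : LabeledPlaneTree S) (π : Equiv.Perm (Fin (S.card - 1))) : LabeledPlaneTree S :=
  { T with label := T.label.trans π }

theorem relabel_injective (T : LabeledPlaneTree S) : Function.Injective (relabel T) := by
  intro π π' h
  have h' : T.label.trans π = T.label.trans π' := by
    simp only [relabel, LabeledPlaneTree.mk.injEq, heq_eq_eq, true_and] at h
    exact h
  ext k
  have := congrArg (fun f => f (T.label.symm k)) h'
  simpa using congrArg Fin.val this

/-- Few relabelings of `T` can be reached by `M` edge slides. -/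
theorem card_edgeSlide_le (hS : InConvexPosition S) (hcard : 1 ≤ S.card)
    (T : LabeledPlaneTree S) (M : ℕ) (B : Finset (Equiv.Perm (Fin (S.card - 1))))
    (hB : ∀ π ∈ B, ∃ m ≤ M, TransformsIn EdgeSlide m T (relabel T π)) :
    B.card ≤ 10 ^ (S.card - 1 + 2 * M) := by
  obtain ⟨a, ha⟩ := exists_represents T
  have hloc := isLocal_step (X := chirotope hS) (I := Fin (S.card - 1))
    (by simp only [Fintype.card_fin, Fintype.card_coe]; omega)
  refine hloc.card_le (d := 2) (M := M) Move.sum_event_length_le B a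
    (fun π a' => Represents a' (relabel T π)) ?_ ?_
  · intro π π' a' h h'
    exact relabel_injective T (tree_ext fun k => (h k).symm.trans (h' k))
  · intro π hπ
    obtain ⟨m, hm, ht⟩ := hB π hπ
    obtain ⟨w, a', hw, hrun, hr⟩ := ha.exists_run (hS := hS) ht
    exact ⟨w, a', hw.trans_le hm, hrun, hr⟩

/-- Few relabelings of `T` can be reached by `M` simultaneous edge slides. -/
theorem card_simultaneousEdgeSlide_le (hS : InConvexPosition S) (hcard : 1 ≤ S.card)
    (T : LabeledPlaneTree S) (M : ℕ) (B : Finset (Equiv.Perm (Fin (S.card - 1))))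
    (hB : ∀ π ∈ B, ∃ m ≤ M, TransformsIn SimultaneousEdgeSlide m T (relabel T π)) :
    B.card ≤ (5 ^ (S.card - 1)) ^ M := by
  -- The naming of the ends is fixed for each tree once and for all, so the code of a step can be
  -- decoded from its first tree alone.
  choose ends hends using fun T : LabeledPlaneTree S => exists_represents T
  let C (T T' : LabeledPlaneTree S) (κ : Fin (S.card - 1) → Option (Bool × Bool)) : Prop :=
    ∀ k, (κ k = none → (T'.label.symm k : Sym2 S) = T.label.symm k) ∧
      ∀ bs, κ k = some bs → ∃ o : Move _, o.Enabled (chirotope hS) (ends T) ∧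
        o.event k = some (true, bs) ∧
        (T'.label.symm k : Sym2 S) = s(ends T o.i !o.b, ends T o.j !o.c)
  have hK : Fintype.card (Fin (S.card - 1) → Option (Bool × Bool)) = 5 ^ (S.card - 1) := by
    simp [Fintype.card_option]
  rw [← hK]
  refine card_le_of_step_code (C := C) ?_ ?_ ?_ B (relabel T) (relabel_injective T) hB
  · intro T
    have he : IsEmpty ↥(T.graph.edgeSet \ T.graph.edgeSet) := by simp
    exact ⟨Equiv.equivOfIsEmpty _ _, fun e => he.elim e, fun _ _ _ => rfl⟩
  · rintro T T' ⟨π, hπ, hk⟩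
    have : ∀ k, ∃ κ : Option (Bool × Bool),
      (κ = none → (T'.label.symm k : Sym2 S) = T.label.symm k) ∧
      ∀ bs, κ = some bs → ∃ o : Move _, o.Enabled (chirotope hS) (ends T) ∧
        o.event k = some (true, bs) ∧
        (T'.label.symm k : Sym2 S) = s(ends T o.i !o.b, ends T o.j !o.c) := by
      intro k
      have hmem := (T.label.symm k).2
      by_cases hmem' : (T.label.symm k : Sym2 S) ∈ T'.graph.edgeSet
      · refine ⟨none, fun _ => label_symm_eq hmem' ?_, by simp⟩
        rw [← hk _ hmem hmem']
        exact T.label.apply_symm_apply k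
      · obtain ⟨hc, hl⟩ := hπ ⟨_, hmem, hmem'⟩
        have h₂ := (π ⟨_, hmem, hmem'⟩).2.1
        obtain ⟨o, ho, hi, he⟩ := (hends T).exists_move (hS := hS) hmem hmem'
          (T'.graph.not_isDiag_of_mem_edgeSet h₂) hc
        have hi' : k = o.i := by rw [hi]; exact (T.label.apply_symm_apply k).symm
        refine ⟨some (o.b, o.s), by simp, ?_⟩
        rintro _ ⟨⟩
        refine ⟨o, ho, if_pos hi', ?_⟩
        rw [he]
        refine label_symm_eq h₂ (hl.trans ?_)
        exact T.label.apply_symm_apply k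
    choose κ hκ using this
    exact ⟨κ, hκ⟩
  · intro T T₁ T₂ κ h₁ h₂
    refine tree_ext fun k => ?_
    cases hk : κ k with
    | none => rw [(h₁ k).1 hk, (h₂ k).1 hk]
    | some bs =>
      obtain ⟨o, ho, he, h⟩ := (h₁ k).2 bs hk
      obtain ⟨o', ho', he', h'⟩ := (h₂ k).2 bs hk
      have := ho.eq_of_event (by simp only [Fintype.card_fin, Fintype.card_coe]; omega)
        (hends T).isPlane ho' he he'
      subst this
      rw [h, h']

end Trees

end EdgeSlideBound

namespace EdgeSlideBound

/-! ### Numerical estimates -/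

section Estimates

theorem log_ten_le : Real.log 10 ≤ 3 := by
  rw [Real.log_le_iff_le_exp (by norm_num), show (3 : ℝ) = (3 : ℕ) * 1 by norm_num, Real.exp_nat_mul]
  calc (10 : ℝ) ≤ 2.7 ^ 3 := by norm_num
    _ ≤ Real.exp 1 ^ 3 := by
      gcongr
      exact (lt_trans (by norm_num) Real.exp_one_gt_d9).le

theorem six_le_log {n : ℕ} (hn : 1000 ≤ n) : 6 ≤ Real.log n := by
  have hn' : (1000 : ℝ) ≤ n := by exact_mod_cast hn
  rw [Real.le_log_iff_exp_le (by linarith), show (6 : ℝ) = (6 : ℕ) * 1 by norm_num, Real.exp_nat_mul]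
  calc Real.exp 1 ^ 6 ≤ (2.72 : ℝ) ^ 6 := by
        gcongr
        exact (Real.exp_one_lt_d9.trans (by norm_num)).le
    _ ≤ (n : ℝ) := le_trans (by norm_num) hn'

theorem mul_log_lt {n : ℕ} (hn : 1 ≤ n) (hn' : n < 1000) : (n : ℝ) * Real.log n < 10000 := by
  have h1 : (1 : ℝ) ≤ n := by exact_mod_cast hn
  have h2 : (n : ℝ) ≤ 1000 := by exact_mod_cast hn'.le
  have h3 : Real.log n ≤ 9 := by
    have := Real.log_le_log (by linarith) h2
    rw [show (1000 : ℝ) = 10 ^ 3 by norm_num, Real.log_pow] at this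
    push_cast at this
    linarith [log_ten_le]
  nlinarith [Real.log_nonneg h1]

/-- In logarithms: $n^n/n! \le e^n$ gives $\log (n-1)! \ge n\log n - n - \log n$, which exceeds
$3(n+2M)$ once $\log n \ge 6$. -/
theorem ten_pow_le_factorial {n M : ℕ} (hn : 1000 ≤ n)
    (hM : (M : ℝ) ≤ 1 / 10000 * (n * Real.log n)) : 10 ^ (n + 2 * M) ≤ (n - 1).factorial := by
  have hn' : (1000 : ℝ) ≤ n := by exact_mod_cast hn
  have hL := six_le_log hn
  have hpos : (0 : ℝ) < n := by linarith
  have hf : ((n - 1).factorial : ℝ) * n = n.factorial := by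
    rw [mul_comm]
    exact_mod_cast Nat.mul_factorial_pred (by omega)
  have hfpos : (0 : ℝ) < (n - 1).factorial := by exact_mod_cast Nat.factorial_pos _
  have hlog : n * Real.log n - n ≤ Real.log (n - 1).factorial + Real.log n := by
    rw [← Real.log_mul hfpos.ne' hpos.ne', hf]
    have h := Real.pow_div_factorial_le_exp (n : ℝ) hpos.le n
    have hfp : (0 : ℝ) < n.factorial := by exact_mod_cast Nat.factorial_pos _
    have := Real.log_le_log (by positivity) h
    rw [Real.log_exp, Real.log_div (by positivity) hfp.ne', Real.log_pow] at this
    linarith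
  have key : ((n + 2 * M : ℕ) : ℝ) * Real.log 10 ≤ Real.log (n - 1).factorial := by
    push_cast
    have h1 : ((n : ℝ) + 2 * M) * Real.log 10 ≤ (n + 2 * M) * 3 :=
      mul_le_mul_of_nonneg_left log_ten_le (by positivity)
    nlinarith
  rw [← Real.log_pow, Real.log_le_log_iff (by positivity) hfpos] at key
  exact_mod_cast key

end Estimates

end EdgeSlideBound

/-! ### The counting argument -/

open EdgeSlideBound in
theorem mainTheorem9 :
    ∃ c : ℝ, 0 < c ∧
      ∀ n : ℕ, 3 ≤ n →
      ∀ S : Finset Plane, S.card = n → InConvexPosition S →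
      ∀ T : LabeledPlaneTree S, ∃ T' : LabeledPlaneTree S,
        (∀ m : ℕ, TransformsIn EdgeSlide m T T' →
          c * ((n : ℝ) * Real.log n) ≤ (m : ℝ)) ∧
        (∀ m : ℕ, TransformsIn SimultaneousEdgeSlide m T T' →
          c * Real.log n ≤ (m : ℝ)) := by
  classical
  refine ⟨1 / 10000, by norm_num, ?_⟩
  rintro n hn S rfl hS T
  have hn1 : (1 : ℝ) ≤ S.card := by exact_mod_cast (by omega : 1 ≤ S.card)
  have hlog : 0 ≤ Real.log S.card := Real.log_nonneg hn1
  -- For small `n` both bounds are below 1, and any nontrivial relabeling needs at least one step.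
  rcases lt_or_ge S.card 1000 with hsmall | hlarge
  · have h1 := mul_log_lt (by omega) hsmall
    have h2 : Real.log S.card ≤ S.card * Real.log S.card := le_mul_of_one_le_left hlog hn1
    have : Nontrivial (Equiv.Perm (Fin (S.card - 1))) := by
      have : Nontrivial (Fin (S.card - 1)) := Fin.nontrivial_iff_two_le.2 (by omega)
      infer_instance
    obtain ⟨π, hπ⟩ := exists_ne (1 : Equiv.Perm (Fin (S.card - 1)))
    have hT : ∀ {op : LabeledPlaneTree S → LabeledPlaneTree S → Prop} {m : ℕ},
        TransformsIn op m T (relabel T π) → (1 : ℝ) ≤ m := by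
      rintro op m ⟨t, h0, hm, -⟩
      have : m ≠ 0 := by
        rintro rfl
        exact hπ (relabel_injective T (hm.symm.trans h0))
      exact_mod_cast Nat.one_le_iff_ne_zero.2 this
    exact ⟨relabel T π, fun m h => by linarith [hT h], fun m h => by linarith [hT h]⟩
  · set M := ⌊1 / 10000 * ((S.card : ℝ) * Real.log S.card)⌋₊ with hM
    set M' := ⌊1 / 10000 * Real.log S.card⌋₊ with hM'
    -- This brings the count $5^{(n-1)M'}$ for simultaneous slides under the bound for single
    -- slides.
    have hMM' : (S.card - 1) * M' ≤ M := by
      apply Nat.le_floor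
      have h1 : (M' : ℝ) ≤ 1 / 10000 * Real.log S.card := Nat.floor_le (by positivity)
      have h2 : ((S.card - 1 : ℕ) : ℝ) ≤ S.card := by exact_mod_cast Nat.sub_le _ _
      push_cast
      calc ((S.card - 1 : ℕ) : ℝ) * M' ≤ S.card * (1 / 10000 * Real.log S.card) := by gcongr
        _ = _ := by ring
    have hfac := ten_pow_le_factorial hlarge (M := M) (Nat.floor_le (by positivity))
    let B := Finset.univ.filter fun π => ∃ m ≤ M, TransformsIn EdgeSlide m T (relabel T π)
    let B' := Finset.univ.filter fun π =>
      ∃ m ≤ M', TransformsIn SimultaneousEdgeSlide m T (relabel T π)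
    have hB : B.card ≤ 10 ^ (S.card - 1 + 2 * M) :=
      card_edgeSlide_le hS (by omega) T M B fun π hπ => (Finset.mem_filter.1 hπ).2
    have hB' : B'.card ≤ 10 ^ (S.card - 1 + 2 * M) := by
      refine (card_simultaneousEdgeSlide_le hS (by omega) T M' B'
        fun π hπ => (Finset.mem_filter.1 hπ).2).trans ?_
      rw [← pow_mul]
      exact (Nat.pow_le_pow_left (by norm_num) _).trans
        (Nat.pow_le_pow_right (by norm_num) (by omega))
    have hlt : (B ∪ B').card < (Finset.univ : Finset (Equiv.Perm (Fin (S.card - 1)))).card := by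
      rw [Finset.card_univ, Fintype.card_perm, Fintype.card_fin]
      refine lt_of_lt_of_le ?_ hfac
      -- The spare factor 10 absorbs the union of the two sets of reachable relabelings.
      have hp : 10 ^ (S.card + 2 * M) = 10 ^ (S.card - 1 + 2 * M) * 10 := by
        rw [← pow_succ]
        congr 1
        omega
      have := Finset.card_union_le B B'
      have : 0 < 10 ^ (S.card - 1 + 2 * M) := by positivity
      omega
    obtain ⟨π, -, hπ⟩ := Finset.exists_mem_notMem_of_card_lt_card hlt
    rw [Finset.mem_union, not_or] at hπ
    refine ⟨relabel T π, fun m h => ?_, fun m h => ?_⟩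
    · by_contra! hlt
      exact hπ.1 (Finset.mem_filter.2 ⟨Finset.mem_univ _, m, Nat.le_floor hlt.le, h⟩)
    · by_contra! hlt
      exact hπ.2 (Finset.mem_filter.2 ⟨Finset.mem_univ _, m, Nat.le_floor hlt.le, h⟩)
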